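/- Let $(\Omega,\Sigma,\mu)$ be a finite measure space, let $Z$ be a real Banach space, and let $X\subseteq Z^*$ be a norm-closed linear subspace which is norming for $Z$, i.e. $|||z|||=\sup\{\langle x,z\rangle : x\in X,\ \|x\|\le 1\}$ defines an equivalent norm on $Z$. Let $\nu:\Sigma\to Z^*$ be a vector measure which is countably additive (for the norm of $Z^*$) and $\mu$-continuous (i.e. $\nu(A)=0$ whenever $A\in\Sigma$ and $\mu(A)=0$; for such $\nu$ this is equivalent to $\lim_{\mu(A)\to 0}\|\nu(A)\|=0$). Assume that $$\overline{\mathrm{co}\Big\{\frac{\nu(B)}{\mu(B)} : B\in\Sigma,\ B\subseteq A,\ \mu(B)>0\Big\}}^{\,w^*}\cap X\neq\emptyset\qquad\text{for every }A\in\Sigma\text{ with }\mu(A)>0,$$ where $\mathrm{co}$ denotes the convex hull and the closure is taken in the weak$^*$ topology of $Z^*$. Then for every $B\in\Sigma$ the functional $z\mapsto\langle\nu(B),z\rangle$ on $Z$ is sequentially continuous with respect to the topology $\sigma(Z,X)$ of pointwise convergence on $X$. -/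

import Mathlib

open MeasureTheory

noncomputable section

variable {Ω Z : Type*} [MeasurableSpace Ω] [NormedAddCommGroup Z] [NormedSpace ℝ Z]

/-- `X ⊆ Z*` is norming for `Z`: the formula `|||z||| = sup {⟨x, z⟩ : x ∈ X, ‖x‖ ≤ 1}` defines a norm
on `Z` which is equivalent to the original one. (The set is nonempty and bounded above by `‖z‖`, so
that the supremum is a genuine one.) -/
def IsNorming (X : Submodule ℝ (StrongDual ℝ Z)) : Prop :=
  ∃ c C : ℝ, 0 < c ∧ 0 < C ∧ ∀ z : Z,
    c * ‖z‖ ≤ sSup {t : ℝ | ∃ x ∈ X, ‖x‖ ≤ 1 ∧ x z = t} ∧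
      sSup {t : ℝ | ∃ x ∈ X, ‖x‖ ≤ 1 ∧ x z = t} ≤ C * ‖z‖

/-- The canonical bilinear pairing `(z, x) ↦ ⟨x, z⟩` of `Z` with a subspace `X ⊆ Z*`. -/
def evalPairing (X : Submodule ℝ (StrongDual ℝ Z)) : Z →ₗ[ℝ] X →ₗ[ℝ] ℝ :=
  ((topDualPairing ℝ Z).comp X.subtype).flip

/-- The topology `σ(Z, X)` on `Z` of pointwise convergence on `X`. -/
abbrev sigmaTopology (X : Submodule ℝ (StrongDual ℝ Z)) : TopologicalSpace Z :=
  inferInstanceAs (TopologicalSpace (WeakBilin (evalPairing X)))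

/-- The average range `{ν(B) / μ(B) : B ∈ Σ, B ⊆ A, μ(B) > 0}`. -/
def averageRange (μ : Measure Ω) (ν : VectorMeasure Ω (StrongDual ℝ Z)) (A : Set Ω) :
    Set (StrongDual ℝ Z) :=
  {y | ∃ B : Set Ω, MeasurableSet B ∧ B ⊆ A ∧ 0 < μ B ∧ y = (μ.real B)⁻¹ • ν B}

/-- Condition (G): for every `A ∈ Σ` with `μ(A) > 0`, the weak* closure of the convex hull of the
average range of `ν` over `A` meets `X`. -/
def ConditionG (μ : Measure Ω) (ν : VectorMeasure Ω (StrongDual ℝ Z))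
    (X : Submodule ℝ (StrongDual ℝ Z)) : Prop :=
  ∀ A : Set Ω, MeasurableSet A → 0 < μ A →
    (closure (StrongDual.toWeakDual '' convexHull ℝ (averageRange μ ν A)) ∩
      (StrongDual.toWeakDual '' (X : Set (StrongDual ℝ Z)) : Set (WeakDual ℝ Z))).Nonempty

end

open Filter Topology Set

/-! ### Signed measures, densities and the dual of `L¹`. -/

section SignedMeasures

variable {Ω : Type*} [MeasurableSpace Ω]

/-! By translation and sign change it suffices that `z n → 0` on `X` excludes `ε ≤ ν B (z n)` for
infinitely many `n`. Banach–Steinhaus on the Banach space `X`, with the norming property, bounds `z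
n`. Along an ultrafilter containing those `n`, the scalar measures `ν · (z n)` converge setwise.
Domination by a multiple of `‖ν ·‖` makes the limit countably additive, with a density `f`; since
`∫_B f ≥ ε`, some `A ⊆ B` of positive measure has `f ≥ δ`. The densities of `ν · (z n)` converge
weakly to `f` in `L¹`, so by Mazur convex combinations `w k` of the tails have densities `g k` close
to `f` in norm. Chebyshev leaves a set `A' ⊆ A` of positive measure on which every `g k ≥ δ / 2`.
Averages of `ν` over subsets of `A'` are then at least `δ / 2` at each `w k`, and so is the `y ∈ X`
supplied by `ConditionG`. But `y (w k) → 0`, a contradiction. -/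

theorem sum_add_sdiff_eq_of_additive {E : Type*} [AddCommGroup E] (g : Set Ω → E)
    (hadd : ∀ A B, MeasurableSet A → MeasurableSet B → Disjoint A B → g (A ∪ B) = g A + g B)
    {s : ℕ → Set Ω} (hs : ∀ i, MeasurableSet (s i)) (hd : Pairwise (Function.onFun Disjoint s))
    (t : Finset ℕ) :
    ∑ i ∈ t, g (s i) + g ((⋃ i, s i) \ ⋃ i ∈ t, s i) = g (⋃ i, s i) := by
  induction t using Finset.induction_on with
  | empty => simp
  | insert a t ha ih =>
    rw [← ih, Finset.sum_insert ha]
    have hm : MeasurableSet ((⋃ i, s i) \ ⋃ i ∈ insert a t, s i) :=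
      (MeasurableSet.iUnion hs).diff (Finset.measurableSet_biUnion _ fun i _ => hs i)
    have hsub : s a ⊆ (⋃ i, s i) \ ⋃ i ∈ t, s i := by
      intro x hx
      refine ⟨mem_iUnion.2 ⟨a, hx⟩, fun hx' => ?_⟩
      simp only [mem_iUnion] at hx'
      obtain ⟨i, hi, hxi⟩ := hx'
      exact (hd (fun h => ha (h ▸ hi) : i ≠ a)).le_bot ⟨hxi, hx⟩
    have hun : (⋃ i, s i) \ ⋃ i ∈ t, s i = s a ∪ ((⋃ i, s i) \ ⋃ i ∈ insert a t, s i) := by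
      rw [Finset.set_biUnion_insert, union_comm (s a) (⋃ i ∈ t, s i), ← sdiff_sdiff,
        union_sdiff_cancel hsub]
    rw [hun, hadd _ _ (hs a) hm]
    · abel
    · rw [Finset.set_biUnion_insert]
      exact disjoint_left.2 fun x hx hx' => hx'.2 (Or.inl hx)

/-- A finitely additive set function which is dominated by a vector measure is a signed measure. -/
theorem exists_signedMeasure_of_dominated {E : Type*} [NormedAddCommGroup E]
    (ν : VectorMeasure Ω E) (g : Set Ω → ℝ) (C : ℝ)
    (hadd : ∀ A B, MeasurableSet A → MeasurableSet B → Disjoint A B → g (A ∪ B) = g A + g B)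
    (hle : ∀ A, MeasurableSet A → |g A| ≤ C * ‖ν A‖) :
    ∃ ξ : SignedMeasure Ω, ∀ A, MeasurableSet A → ξ A = g A := by
  classical
  refine ⟨⟨fun A => if MeasurableSet A then g A else 0, ?_, fun A hA => if_neg hA, ?_⟩,
    fun A hA => if_pos hA⟩
  · simpa using hle ∅ MeasurableSet.empty
  · intro s hs hd
    simp only [hs, if_true, MeasurableSet.iUnion hs]
    have hν := ν.m_iUnion hs hd
    rw [HasSum, tendsto_iff_norm_sub_tendsto_zero] at hν ⊢
    refine squeeze_zero (fun _ => norm_nonneg _) (fun t => ?_) (by simpa using hν.const_mul C)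
    -- Each partial-sum error is minus the value on the leftover set, so domination transfers
    -- convergence from `ν` to `g`.
    have h1 := sum_add_sdiff_eq_of_additive g hadd hs hd t
    have h2 := sum_add_sdiff_eq_of_additive ν (fun A B hA hB h => ν.of_union h hA hB) hs hd t
    rw [← h1, ← h2, sub_add_cancel_left, sub_add_cancel_left, norm_neg, norm_neg]
    exact hle _ ((MeasurableSet.iUnion hs).diff (Finset.measurableSet_biUnion _ fun i _ => hs i))

variable (μ : Measure Ω)

theorem exists_density_of_null [IsFiniteMeasure μ] {s : SignedMeasure Ω}
    (hs : ∀ A, MeasurableSet A → μ A = 0 → s A = 0) :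
    ∃ f : Ω → ℝ, Measurable f ∧ Integrable f μ ∧ ∀ A, MeasurableSet A → ∫ x in A, f x ∂μ = s A := by
  have hac : s ≪ᵥ μ.toENNRealVectorMeasure := by
    refine VectorMeasure.AbsolutelyContinuous.mk fun A hA h => hs A hA ?_
    rwa [Measure.toENNRealVectorMeasure_apply_measurable hA] at h
  have hi := SignedMeasure.integrable_rnDeriv s μ
  refine ⟨s.rnDeriv μ, SignedMeasure.measurable_rnDeriv s μ, hi, fun A hA => ?_⟩
  rw [← withDensityᵥ_apply hi hA,
    (SignedMeasure.absolutelyContinuous_iff_withDensityᵥ_rnDeriv_eq s μ).1 hac]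

/-- Split the space by the sign of the function; each half contributes at most `K`. -/
theorem integral_abs_le_of_abs_setIntegral_le {f : Ω → ℝ} (hf : Integrable f μ) {K : ℝ}
    (hK : ∀ A, MeasurableSet A → |∫ x in A, f x ∂μ| ≤ K) : ∫ x, |f x| ∂μ ≤ 2 * K := by
  obtain ⟨g, hgm, hg⟩ := hf.1
  have hgi : Integrable g μ := hf.congr hg
  have hK' : ∀ A, MeasurableSet A → |∫ x in A, g x ∂μ| ≤ K := fun A hA => by
    rw [← integral_congr_ae (ae_restrict_of_ae hg)]; exact hK A hA
  rw [integral_congr_ae (hg.mono fun x hx => by simp only [hx] : (fun x => |f x|) =ᵐ[μ] fun x => |g x|)]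
  have hA : MeasurableSet {x | 0 ≤ g x} := measurableSet_le measurable_const hgm.measurable
  rw [← integral_add_compl hA hgi.abs]
  have h1 : ∫ x in {x | 0 ≤ g x}, |g x| ∂μ = ∫ x in {x | 0 ≤ g x}, g x ∂μ :=
    setIntegral_congr_fun hA fun x hx => abs_of_nonneg hx
  have h2 : ∫ x in {x | 0 ≤ g x}ᶜ, |g x| ∂μ = - ∫ x in {x | 0 ≤ g x}ᶜ, g x ∂μ := by
    rw [← integral_neg]
    exact setIntegral_congr_fun hA.compl fun x hx => abs_of_neg (not_le.1 hx)
  have h3 := hK' _ hA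
  have h4 := hK' _ hA.compl
  rw [h1, h2]
  linarith [(abs_le.1 h3).2, (abs_le.1 h4).1]

/-- The dual of `L¹` of a finite measure consists of bounded functions. -/
theorem exists_bounded_representative_of_dual [IsFiniteMeasure μ]
    (Λ : StrongDual ℝ (Lp ℝ 1 μ)) :
    ∃ h : Ω → ℝ, Measurable h ∧ (∀ x, |h x| ≤ ‖Λ‖) ∧ ∀ f : Lp ℝ 1 μ, Λ f = ∫ x, h x * f x ∂μ := by
  classical
  let g : Set Ω → ℝ := fun A =>
    if hA : MeasurableSet A then Λ (indicatorConstLp 1 hA (measure_ne_top μ A) 1) else 0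
  have hg : ∀ A (hA : MeasurableSet A),
      g A = Λ (indicatorConstLp 1 hA (measure_ne_top μ A) 1) := fun A hA => dif_pos hA
  have hle : ∀ A, MeasurableSet A → |g A| ≤ ‖Λ‖ * μ.real A := fun A hA => by
    rw [hg A hA]
    refine (Λ.le_opNorm _).trans (mul_le_mul_of_nonneg_left ?_ (norm_nonneg _))
    simpa using norm_indicatorConstLp_le (p := 1) (hs := hA) (hμs := measure_ne_top μ A) (c := (1:ℝ))
  obtain ⟨ξ, hξ⟩ := exists_signedMeasure_of_dominated μ.toSignedMeasure g ‖Λ‖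
    (fun A B hA hB h => by
      rw [hg _ (hA.union hB), hg A hA, hg B hB, ← map_add]
      congr 1
      exact indicatorConstLp_disjoint_union hA hB (measure_ne_top μ A) (measure_ne_top μ B) h 1)
    (fun A hA => by
      rw [Measure.toSignedMeasure_apply_measurable hA, Real.norm_of_nonneg measureReal_nonneg]
      exact hle A hA)
  obtain ⟨h, hm, hi, hh⟩ := exists_density_of_null μ (s := ξ) (fun A hA h0 => by
    have := hle A hA
    rw [measureReal_def, h0, ENNReal.toReal_zero, mul_zero] at this
    rw [hξ A hA]
    exact abs_nonpos_iff.1 this)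
  have hub : h ≤ᵐ[μ] fun _ => ‖Λ‖ := by
    refine ae_le_of_forall_setIntegral_le hi (integrable_const _) fun A hA _ => ?_
    rw [hh A hA, hξ A hA, setIntegral_const, smul_eq_mul, mul_comm]
    exact (abs_le.1 (hle A hA)).2
  have hlb : (fun _ => -‖Λ‖) ≤ᵐ[μ] h := by
    refine ae_le_of_forall_setIntegral_le (integrable_const _) hi fun A hA _ => ?_
    rw [hh A hA, hξ A hA, setIntegral_const, smul_eq_mul, mul_neg, mul_comm]
    exact (abs_le.1 (hle A hA)).1
  -- Truncation turns the almost everywhere bound into one valid at every point.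
  have hbm : Measurable fun x => max (-‖Λ‖) (min ‖Λ‖ (h x)) :=
    measurable_const.max (measurable_const.min hm)
  have hbb : ∀ x, |max (-‖Λ‖) (min ‖Λ‖ (h x))| ≤ ‖Λ‖ := fun x =>
    abs_le.2 ⟨le_max_left _ _, max_le (by linarith [norm_nonneg Λ]) (min_le_left _ _)⟩
  have hae : (fun x => max (-‖Λ‖) (min ‖Λ‖ (h x))) =ᵐ[μ] h := by
    filter_upwards [hub, hlb] with x h1 h2
    rw [min_eq_right h1, max_eq_right h2]
  refine ⟨_, hbm, hbb, ?_⟩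
  set b := fun x => max (-‖Λ‖) (min ‖Λ‖ (h x)) with hb
  have hint : ∀ f : Lp ℝ 1 μ, Integrable (fun x => b x * f x) μ := fun f =>
    (L1.integrable_coeFn f).bdd_mul hbm.aestronglyMeasurable (Eventually.of_forall hbb)
  refine Lp.induction (p := 1) ENNReal.one_ne_top _ ?_ ?_ ?_
  · intro c s hs hμs
    rw [Lp.simpleFunc.coe_indicatorConst]
    have e1 : indicatorConstLp 1 hs hμs.ne c = c • indicatorConstLp 1 hs hμs.ne (1:ℝ) := by
      rw [indicatorConstLp, indicatorConstLp, ← MemLp.toLp_const_smul]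
      congr 1
      ext x
      by_cases hx : x ∈ s <;> simp [hx]
    have e2 : ∫ x, b x * indicatorConstLp 1 hs hμs.ne c x ∂μ = c * ∫ x in s, h x ∂μ := by
      rw [← integral_const_mul, ← integral_indicator hs]
      refine integral_congr_ae ?_
      filter_upwards [hae, indicatorConstLp_coeFn (p := 1) (hs := hs) (hμs := hμs.ne) (c := c)]
        with x h1 h2
      rw [h1, h2]
      by_cases hx : x ∈ s <;> simp [hx, mul_comm]
    rw [e2, hh s hs, hξ s hs, hg s hs, e1, map_smul, smul_eq_mul]
  · intro f g hf hg _ h1 h2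
    rw [map_add, h1, h2, ← integral_add (hint _) (hint _)]
    refine integral_congr_ae ?_
    filter_upwards [Lp.coeFn_add (hf.toLp f) (hg.toLp g)] with x hx
    rw [hx, Pi.add_apply, mul_add]
  · refine isClosed_eq Λ.continuous ?_
    refine LipschitzWith.continuous (K := ‖Λ‖₊) (LipschitzWith.of_dist_le_mul fun f g => ?_)
    rw [dist_eq_norm, dist_eq_norm, ← integral_sub (hint f) (hint g), L1.norm_eq_integral_norm,
      coe_nnnorm, ← integral_const_mul]
    refine (norm_integral_le_integral_norm _).trans (integral_mono_ae ?_ ?_ ?_)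
    · exact ((hint f).sub (hint g)).norm
    · exact (L1.integrable_coeFn (f - g)).norm.const_mul _
    · filter_upwards [Lp.coeFn_sub f g] with x hx
      rw [hx, Pi.sub_apply, ← mul_sub, norm_mul]
      exact mul_le_mul_of_nonneg_right (hbb x) (norm_nonneg _)

/-- A bounded measurable function is a uniform limit of simple functions. -/
theorem exists_simpleFunc_abs_sub_le {h : Ω → ℝ} (hm : Measurable h) {K : ℝ}
    (hK : ∀ x, |h x| ≤ K) {ε : ℝ} (hε : 0 < ε) : ∃ s : SimpleFunc Ω ℝ, ∀ x, |h x - s x| ≤ ε := by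
  have hmf : Measurable fun x => ⌊h x / ε⌋ := (hm.div_const ε).floor
  refine ⟨⟨fun x => ε * (⌊h x / ε⌋ : ℤ), fun y => ?_, ?_⟩, fun x => ?_⟩
  · exact (measurable_const.mul (measurable_from_top.comp hmf)) (measurableSet_singleton y)
  · refine ((finite_Icc ⌊-K / ε⌋ ⌊K / ε⌋).image fun n : ℤ => ε * (n : ℝ)).subset ?_
    rintro _ ⟨x, rfl⟩
    refine ⟨⌊h x / ε⌋, ⟨Int.floor_mono ?_, Int.floor_mono ?_⟩, rfl⟩
    · exact div_le_div_of_nonneg_right (abs_le.1 (hK x)).1 hε.le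
    · exact div_le_div_of_nonneg_right (abs_le.1 (hK x)).2 hε.le
  · change |h x - ε * (⌊h x / ε⌋ : ℤ)| ≤ ε
    have e : h x - ε * (⌊h x / ε⌋ : ℤ) = ε * Int.fract (h x / ε) := by
      rw [Int.fract, mul_sub, mul_div_cancel₀ _ hε.ne']
    rw [e, abs_of_nonneg (mul_nonneg hε.le (Int.fract_nonneg _))]
    exact mul_le_of_le_one_right hε.le (Int.fract_lt_one _).le

theorem tendsto_integral_simpleFunc_mul {ι : Type*} {l : Filter ι} {F : ι → Ω → ℝ} {f : Ω → ℝ}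
    (hF : ∀ i, Integrable (F i) μ) (hf : Integrable f μ)
    (hlim : ∀ A, MeasurableSet A →
      Tendsto (fun i => ∫ x in A, F i x ∂μ) l (𝓝 (∫ x in A, f x ∂μ))) (s : SimpleFunc Ω ℝ) :
    Tendsto (fun i => ∫ x, s x * F i x ∂μ) l (𝓝 (∫ x, s x * f x ∂μ)) := by
  have hint : ∀ (s : SimpleFunc Ω ℝ) {u : Ω → ℝ}, Integrable u μ →
      Integrable (fun x => s x * u x) μ := fun s u hu => by
    obtain ⟨C, hC⟩ := s.exists_forall_norm_le
    exact hu.bdd_mul s.aestronglyMeasurable (Eventually.of_forall hC)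
  induction s using SimpleFunc.induction with
  | const c hs =>
    rename_i A
    have e : ∀ u : Ω → ℝ, ∫ x, (SimpleFunc.piecewise A hs (SimpleFunc.const Ω c)
        (SimpleFunc.const Ω 0)) x * u x ∂μ = c * ∫ x in A, u x ∂μ := fun u => by
      rw [← integral_const_mul, ← integral_indicator hs]
      congr 1 with x
      by_cases hx : x ∈ A <;> simp [hx]
    simp only [e]
    exact (hlim A hs).const_mul c
  | add _ h1 h2 =>
    rename_i s t _
    simp only [SimpleFunc.coe_add, Pi.add_apply, add_mul]
    simp only [integral_add (hint s (hF _)) (hint t (hF _)), integral_add (hint s hf) (hint t hf)]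
    exact h1.add h2

/-- A sequence bounded in `L¹` whose integrals over all measurable sets converge to those of `f`
converges to `f` against bounded measurable functions. -/
theorem tendsto_integral_bounded_mul {ι : Type*} {l : Filter ι} {F : ι → Ω → ℝ} {f : Ω → ℝ}
    (hF : ∀ i, Integrable (F i) μ) (hf : Integrable f μ) {K : ℝ} (hK : ∀ i, ∫ x, |F i x| ∂μ ≤ K)
    (hlim : ∀ A, MeasurableSet A →
      Tendsto (fun i => ∫ x in A, F i x ∂μ) l (𝓝 (∫ x in A, f x ∂μ)))
    {h : Ω → ℝ} (hm : Measurable h) {C : ℝ} (hC : ∀ x, |h x| ≤ C) :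
    Tendsto (fun i => ∫ x, h x * F i x ∂μ) l (𝓝 (∫ x, h x * f x ∂μ)) := by
  have hint : ∀ {u : Ω → ℝ}, Integrable u μ → Integrable (fun x => h x * u x) μ := fun hu =>
    hu.bdd_mul hm.aestronglyMeasurable (Eventually.of_forall hC)
  have hints : ∀ (s : SimpleFunc Ω ℝ) {u : Ω → ℝ}, Integrable u μ →
      Integrable (fun x => s x * u x) μ := fun s u hu => by
    obtain ⟨C, hC⟩ := s.exists_forall_norm_le
    exact hu.bdd_mul s.aestronglyMeasurable (Eventually.of_forall hC)
  have hap : ∀ {δ : ℝ} (s : SimpleFunc Ω ℝ), (∀ x, |h x - s x| ≤ δ) → ∀ {u : Ω → ℝ},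
      Integrable u μ → |∫ x, h x * u x ∂μ - ∫ x, s x * u x ∂μ| ≤ δ * ∫ x, |u x| ∂μ := by
    intro δ s hs u hu
    rw [← integral_sub (hint hu) (hints s hu), ← integral_const_mul]
    refine (abs_integral_le_integral_abs).trans (integral_mono ?_ (hu.abs.const_mul _) fun x => ?_)
    · exact ((hint hu).sub (hints s hu)).abs
    · simp only [← sub_mul, abs_mul]
      exact mul_le_mul_of_nonneg_right (hs x) (abs_nonneg _)
  rw [Metric.tendsto_nhds]
  intro ε hε
  -- `L` dominates the `L¹` norms of `f` and of all `F i`; the `1` keeps it positive.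
  set L := |K| + ∫ x, |f x| ∂μ + 1 with hL
  have hfn : 0 ≤ ∫ x, |f x| ∂μ := integral_nonneg fun x => abs_nonneg _
  have hLpos : 0 < L := by positivity
  obtain ⟨s, hs⟩ := exists_simpleFunc_abs_sub_le hm hC (ε := ε / (3 * L)) (by positivity)
  have hδ : ∀ r, r ≤ L → ε / (3 * L) * r ≤ ε / 3 := fun r hr => by
    calc ε / (3 * L) * r ≤ ε / (3 * L) * L := by gcongr
      _ = ε / 3 := by field_simp
  filter_upwards [Metric.tendsto_nhds.1 (tendsto_integral_simpleFunc_mul μ hF hf hlim s) (ε / 3)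
    (by positivity)] with i hi
  rw [Real.dist_eq] at hi ⊢
  have h1 := (hap s hs (hF i)).trans (hδ _ (by linarith [hK i, le_abs_self K]))
  have h2 := (hap s hs hf).trans (hδ _ (by linarith [abs_nonneg K]))
  rw [abs_le] at h1 h2
  rw [abs_lt] at hi ⊢
  constructor <;> linarith [h1.1, h1.2, h2.1, h2.2, hi.1, hi.2]

end SignedMeasures

/-! ### Mazur's lemma in `L¹`. -/

section Mazur

variable {Ω : Type*} [MeasurableSpace Ω] (μ : Measure Ω) [IsFiniteMeasure μ]

/-- If the densities `F i` converge to `f` weakly in `L¹`, then `f` is approximated in `L¹` by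
elements of any convex class of functions that eventually contains them. -/
theorem exists_integral_abs_sub_lt_of_tendsto_setIntegral {ι : Type*} {l : Filter ι} [l.NeBot]
    {F : ι → Ω → ℝ} {f : Ω → ℝ} (hF : ∀ i, Integrable (F i) μ) (hf : Integrable f μ) {K : ℝ}
    (hK : ∀ i, ∫ x, |F i x| ∂μ ≤ K)
    (hlim : ∀ A, MeasurableSet A →
      Tendsto (fun i => ∫ x in A, F i x ∂μ) l (𝓝 (∫ x in A, f x ∂μ)))
    {S : Set (Lp ℝ 1 μ)} (hS : Convex ℝ S)
    (hFS : ∀ᶠ i in l, (hF i).toL1 (F i) ∈ S) {η : ℝ} (hη : 0 < η) :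
    ∃ g ∈ S, ∫ x, |g x - f x| ∂μ < η := by
  have hmem : hf.toL1 f ∈ closure S := by
    by_contra hn
    -- A functional strictly separating `f` from `S` is a bounded function, which contradicts weak
    -- convergence.
    obtain ⟨Λ, u, hu, hS'⟩ := geometric_hahn_banach_point_closed hS.closure isClosed_closure hn
    obtain ⟨h, hm, hb, hΛ⟩ := exists_bounded_representative_of_dual μ Λ
    have e : ∀ {v : Ω → ℝ} (hv : Integrable v μ), Λ (hv.toL1 v) = ∫ x, h x * v x ∂μ := fun hv => by
      rw [hΛ]
      refine integral_congr_ae ?_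
      filter_upwards [hv.coeFn_toL1] with x hx
      rw [hx]
    have ht := tendsto_integral_bounded_mul μ hF hf hK hlim hm hb
    rw [← e hf] at ht
    refine absurd hu (not_lt.2 (ge_of_tendsto ht ?_))
    filter_upwards [hFS] with i hi
    rw [← e (hF i)]
    exact (hS' _ (subset_closure hi)).le
  obtain ⟨g, hg, hd⟩ := Metric.mem_closure_iff.1 hmem η hη
  refine ⟨g, hg, ?_⟩
  rw [dist_comm, dist_eq_norm, L1.norm_eq_integral_norm] at hd
  refine lt_of_eq_of_lt (integral_congr_ae ?_) hd
  filter_upwards [hf.coeFn_toL1, Lp.coeFn_sub g (hf.toL1 f)] with x h1 h2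
  rw [h2, Pi.sub_apply, h1, Real.norm_eq_abs]

end Mazur

/-! ### The contradiction argument. -/

section Main

variable {Ω Z : Type*} [MeasurableSpace Ω] [NormedAddCommGroup Z] [NormedSpace ℝ Z]

theorem exists_uniform_bound_of_pointwise_bounded {V : Type*} [NormedAddCommGroup V]
    [NormedSpace ℝ V] [CompleteSpace V] (L : ℕ → V →ₗ[ℝ] ℝ)
    (hL : ∀ n, ∃ K, ∀ v, |L n v| ≤ K * ‖v‖) (hpt : ∀ v, ∃ C, ∀ n, |L n v| ≤ C) :
    ∃ C, ∀ n v, |L n v| ≤ C * ‖v‖ := by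
  choose K hK using hL
  obtain ⟨C, hC⟩ := banach_steinhaus (g := fun n => (L n).mkContinuous (K n) (hK n)) hpt
  exact ⟨C, fun n v => ((L n).mkContinuous (K n) (hK n)).le_of_opNorm_le (hC n) v⟩

theorem IsNorming.exists_norm_le {X : Submodule ℝ (StrongDual ℝ Z)}
    (hX : IsNorming X) (hXc : IsClosed (X : Set (StrongDual ℝ Z))) {z : ℕ → Z}
    (hz : ∀ x ∈ X, Tendsto (fun n => x (z n)) atTop (𝓝 0)) : ∃ M, ∀ n, ‖z n‖ ≤ M := by
  have : CompleteSpace X := hXc.completeSpace_coe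
  have hL : ∀ n, ∃ K, ∀ x : X, |evalPairing X (z n) x| ≤ K * ‖x‖ := fun n =>
    ⟨‖z n‖, fun x => by rw [mul_comm]; exact (x : StrongDual ℝ Z).le_opNorm (z n)⟩
  have hpt : ∀ x : X, ∃ C, ∀ n, |evalPairing X (z n) x| ≤ C := fun x => by
    obtain ⟨C, hC⟩ := (hz x x.2).abs.bddAbove_range
    exact ⟨C, fun n => hC ⟨n, rfl⟩⟩
  obtain ⟨C, hC⟩ := exists_uniform_bound_of_pointwise_bounded (V := X)
    (fun n => evalPairing X (z n)) hL hpt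
  obtain ⟨c, _, hc, _, h⟩ := hX
  refine ⟨|C| / c, fun n => ?_⟩
  rw [le_div_iff₀' hc]
  refine (h (z n)).1.trans (csSup_le ⟨0, 0, X.zero_mem, by simp, by simp⟩ ?_)
  rintro t ⟨x, hx, hx1, rfl⟩
  calc x (z n) ≤ |x (z n)| := le_abs_self _
    _ ≤ C * ‖x‖ := hC n ⟨x, hx⟩
    _ ≤ |C| * 1 := mul_le_mul (le_abs_self C) hx1 (norm_nonneg x) (abs_nonneg C)
    _ = |C| := mul_one _

/-- The scalar measure `A ↦ ⟨ν A, z⟩` has a density. -/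
theorem exists_density_eval (μ : Measure Ω) [IsFiniteMeasure μ]
    (ν : VectorMeasure Ω (StrongDual ℝ Z)) (hν : ∀ A, MeasurableSet A → μ A = 0 → ν A = 0) (z : Z) :
    ∃ f : Ω → ℝ, Integrable f μ ∧ ∀ A, MeasurableSet A → ∫ x in A, f x ∂μ = ν A z := by
  obtain ⟨ξ, hξ⟩ := exists_signedMeasure_of_dominated ν (fun A => ν A z) ‖z‖
    (fun A B hA hB h => by rw [ν.of_union h hA hB]; rfl)
    (fun A _ => by rw [mul_comm]; exact (ν A).le_opNorm z)
  obtain ⟨f, -, hf, h⟩ := exists_density_of_null μ (s := ξ) fun A hA h0 => by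
    rw [hξ A hA, hν A hA h0]; rfl
  exact ⟨f, hf, fun A hA => by rw [h A hA, hξ A hA]⟩

/-- The ultrafilter limit of `A ↦ ⟨ν A, z n⟩` along a bounded sequence has a density. -/
theorem exists_density_ultrafilter_limit (μ : Measure Ω) [IsFiniteMeasure μ]
    (ν : VectorMeasure Ω (StrongDual ℝ Z)) (hν : ∀ A, MeasurableSet A → μ A = 0 → ν A = 0)
    {z : ℕ → Z} {M : ℝ} (hM : ∀ n, ‖z n‖ ≤ M) (U : Ultrafilter ℕ) :
    ∃ f : Ω → ℝ, Measurable f ∧ Integrable f μ ∧ ∀ A, MeasurableSet A →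
      Tendsto (fun n => ν A (z n)) U (𝓝 (∫ x in A, f x ∂μ)) := by
  have hb : ∀ A n, ν A (z n) ∈ Icc (-(M * ‖ν A‖)) (M * ‖ν A‖) := fun A n => by
    refine abs_le.1 (((ν A).le_opNorm (z n)).trans ?_)
    rw [mul_comm]
    exact mul_le_mul_of_nonneg_right (hM n) (norm_nonneg _)
  have hex : ∀ A, ∃ r ∈ Icc (-(M * ‖ν A‖)) (M * ‖ν A‖), Tendsto (fun n => ν A (z n)) U (𝓝 r) :=
    fun A => isCompact_Icc.ultrafilter_le_nhds (U.map fun n => ν A (z n))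
      (le_principal_iff.2 (mem_map.2 (univ_mem' (hb A))))
  choose g hg hlim using hex
  obtain ⟨ξ, hξ⟩ := exists_signedMeasure_of_dominated ν g M
    (fun A B hA hB h => by
      refine tendsto_nhds_unique (hlim (A ∪ B)) ?_
      simpa [ν.of_union h hA hB] using (hlim A).add (hlim B))
    (fun A _ => abs_le.2 (hg A))
  obtain ⟨f, hfm, hf, h⟩ := exists_density_of_null μ (s := ξ) fun A hA h0 => by
    rw [hξ A hA]
    simpa [hν A hA h0] using hg A
  exact ⟨f, hfm, hf, fun A hA => by rw [h A hA, hξ A hA]; exact hlim A⟩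

theorem exists_measure_pos_of_setIntegral_pos (μ : Measure Ω) [IsFiniteMeasure μ] {f : Ω → ℝ}
    (hf : Integrable f μ) {B : Set Ω} (hB : MeasurableSet B) (hpos : 0 < ∫ x in B, f x ∂μ) :
    ∃ δ > 0, 0 < μ {x ∈ B | δ ≤ f x} := by
  set ε := ∫ x in B, f x ∂μ with hε
  have hμ : 0 ≤ μ.real B := measureReal_nonneg
  -- If `f` were below this value a.e. on `B`, then `∫_B f ≤ ε μ(B) / (μ(B) + 1) < ε`.
  refine ⟨ε / (μ.real B + 1), by positivity, pos_iff_ne_zero.2 fun h0 => ?_⟩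
  have hle : ε ≤ ∫ _ in B, ε / (μ.real B + 1) ∂μ := by
    refine setIntegral_mono_on_ae hf.integrableOn (integrable_const _) hB ?_
    filter_upwards [measure_eq_zero_iff_ae_notMem.1 h0] with x hx hxB
    by_contra hn
    exact hx ⟨hxB, (not_le.1 hn).le⟩
  rw [setIntegral_const, smul_eq_mul, mul_div_assoc', le_div_iff₀ (by positivity)] at hle
  nlinarith

/-- The half-space `r ≤ φ w` is convex and weak* closed, so it suffices to check the averages
themselves. -/
theorem averageRange_eval_ge (μ : Measure Ω) [IsFiniteMeasure μ]
    {ν : VectorMeasure Ω (StrongDual ℝ Z)} {A : Set Ω} {w : Z} {r : ℝ}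
    (h : ∀ C, MeasurableSet C → C ⊆ A → r * μ.real C ≤ ν C w) {y : StrongDual ℝ Z}
    (hy : StrongDual.toWeakDual y ∈
      closure (StrongDual.toWeakDual '' convexHull ℝ (averageRange μ ν A))) : r ≤ y w := by
  have hcl : IsClosed {φ : WeakDual ℝ Z | r ≤ φ w} :=
    isClosed_le continuous_const (WeakDual.eval_continuous w)
  have hconv : Convex ℝ {φ : StrongDual ℝ Z | r ≤ φ w} :=
    convex_halfSpace_ge (f := fun φ : StrongDual ℝ Z => φ w)
      ⟨fun _ _ => rfl, fun _ _ => rfl⟩ r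
  have hsub : convexHull ℝ (averageRange μ ν A) ⊆ {φ : StrongDual ℝ Z | r ≤ φ w} := by
    refine convexHull_min ?_ hconv
    rintro _ ⟨C, hC, hCA, hpos, rfl⟩
    have hp : 0 < μ.real C := ENNReal.toReal_pos hpos.ne' (measure_ne_top μ C)
    change r ≤ (μ.real C)⁻¹ * ν C w
    rw [inv_mul_eq_div, le_div_iff₀ hp]
    exact h C hC hCA
  have hsub' : StrongDual.toWeakDual '' convexHull ℝ (averageRange μ ν A) ⊆
      {φ : WeakDual ℝ Z | r ≤ φ w} := image_subset_iff.2 fun φ hφ => hsub hφ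
  exact closure_minimal hsub' hcl hy

/-- A bounded sequence converging to zero pointwise on `X` cannot be frequently bounded below
on a value of `ν`. -/
theorem ConditionG.not_frequently_le {μ : Measure Ω} [IsFiniteMeasure μ]
    {X : Submodule ℝ (StrongDual ℝ Z)} {ν : VectorMeasure Ω (StrongDual ℝ Z)}
    (hG : ConditionG μ ν X) (hν : ∀ A, MeasurableSet A → μ A = 0 → ν A = 0)
    {z : ℕ → Z} {M : ℝ} (hM : ∀ n, ‖z n‖ ≤ M)
    (hz : ∀ x ∈ X, Tendsto (fun n => x (z n)) atTop (𝓝 0))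
    {B : Set Ω} (hB : MeasurableSet B) {ε : ℝ} (hε : 0 < ε) :
    ¬ ∃ᶠ n in atTop, ε ≤ ν B (z n) := by
  intro hfreq
  have : NeBot (atTop ⊓ 𝓟 {n | ε ≤ ν B (z n)}) := frequently_mem_iff_neBot.1 hfreq
  set U := Ultrafilter.of (atTop ⊓ 𝓟 {n | ε ≤ ν B (z n)}) with hU
  have hUle : (U : Filter ℕ) ≤ atTop ⊓ 𝓟 {n | ε ≤ ν B (z n)} := Ultrafilter.of_le _
  have hU1 : (U : Filter ℕ) ≤ atTop := hUle.trans inf_le_left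
  have hU2 : ∀ᶠ n in (U : Filter ℕ), ε ≤ ν B (z n) := le_principal_iff.1 (hUle.trans inf_le_right)
  obtain ⟨f, hfm, hf, hlim⟩ := exists_density_ultrafilter_limit μ ν hν hM U
  obtain ⟨δ, hδ, hA⟩ := exists_measure_pos_of_setIntegral_pos μ hf hB
    (hε.trans_le (ge_of_tendsto (hlim B hB) hU2))
  set A := {x ∈ B | δ ≤ f x} with hAdef
  have hAm : MeasurableSet A := hB.inter (measurableSet_le measurable_const hfm)
  choose F hF hFν using fun n => exists_density_eval μ ν hν (z n)
  have hFb : ∀ n, ∫ x, |F n x| ∂μ ≤ 2 * (M * ν.bound) := fun n =>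
    integral_abs_le_of_abs_setIntegral_le μ (hF n) fun C hC => by
      rw [hFν n C hC]
      refine ((ν C).le_opNorm (z n)).trans ?_
      rw [mul_comm]
      exact mul_le_mul (hM n) ν.norm_apply_le_bound (norm_nonneg _)
        ((norm_nonneg _).trans (hM n))
  have happrox : ∀ (k : ℕ) {η : ℝ}, 0 < η → ∃ w ∈ convexHull ℝ (z '' Ici k),
      ∃ g : Lp ℝ 1 μ, (∀ C, MeasurableSet C → ∫ x in C, g x ∂μ = ν C w) ∧
        ∫ x, |g x - f x| ∂μ < η := by
    intro k η hη
    -- Since `w ↦ ν C w` is linear, these densities form a convex set; it contains `F n` for all `n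
    -- ≥ k`.
    let S : Set (Lp ℝ 1 μ) := {g | ∃ w ∈ convexHull ℝ (z '' Ici k),
      ∀ C, MeasurableSet C → ∫ x in C, g x ∂μ = ν C w}
    have hS : Convex ℝ S := by
      rintro g₁ ⟨w₁, hw₁, h₁⟩ g₂ ⟨w₂, hw₂, h₂⟩ a b ha hb hab
      refine ⟨a • w₁ + b • w₂, convex_convexHull ℝ _ hw₁ hw₂ ha hb hab, fun C hC => ?_⟩
      rw [map_add, map_smul, map_smul, ← h₁ C hC, ← h₂ C hC, smul_eq_mul, smul_eq_mul,
        ← integral_const_mul, ← integral_const_mul,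
        ← integral_add ((L1.integrable_coeFn g₁).const_mul a).integrableOn
          ((L1.integrable_coeFn g₂).const_mul b).integrableOn]
      refine integral_congr_ae (ae_restrict_of_ae ?_)
      filter_upwards [Lp.coeFn_add (a • g₁) (b • g₂), Lp.coeFn_smul a g₁, Lp.coeFn_smul b g₂]
        with x h1 h2 h3
      rw [h1, Pi.add_apply, h2, h3, Pi.smul_apply, Pi.smul_apply, smul_eq_mul, smul_eq_mul]
    obtain ⟨g, ⟨w, hw, hg⟩, h⟩ := exists_integral_abs_sub_lt_of_tendsto_setIntegral μ hF hf hFb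
      (l := U) (fun C hC => by simpa only [hFν _ C hC] using hlim C hC) hS
      (by
        filter_upwards [hU1 (Ici_mem_atTop k)] with n hn
        refine ⟨z n, subset_convexHull ℝ _ ⟨n, hn, rfl⟩, fun C hC => ?_⟩
        rw [← hFν n C hC]
        exact integral_congr_ae (ae_restrict_of_ae (hF n).coeFn_toL1)) hη
    exact ⟨w, hw, g, hg, h⟩
  -- With `L¹` error below `δ / 2 * η k`, Chebyshev gives `μ (E k) ≤ η k`, and the sum stays below
  -- `μ A`.
  obtain ⟨η, hη, hηsum⟩ := ENNReal.exists_pos_sum_of_countable hA.ne' ℕ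
  choose w hw g hgν hgf using fun k => happrox k (mul_pos (half_pos hδ) (NNReal.coe_pos.2 (hη k)))
  have hgi : ∀ k, Integrable (fun x => |g k x - f x|) μ := fun k =>
    ((L1.integrable_coeFn (g k)).sub hf).abs
  let E : ℕ → Set Ω := fun k => {x | δ / 2 ≤ |g k x - f x|}
  have hEm : ∀ k, MeasurableSet (E k) := fun k =>
    measurableSet_le measurable_const ((Lp.stronglyMeasurable (g k)).measurable.sub hfm).abs
  have hE : ∀ k, μ (E k) ≤ η k := fun k => by
    have h1 := mul_meas_ge_le_integral_of_nonneg (μ := μ)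
      (Eventually.of_forall fun x => abs_nonneg (g k x - f x)) (hgi k) (δ / 2)
    have h2 : μ.real (E k) ≤ η k := le_of_mul_le_mul_left (h1.trans (hgf k).le) (half_pos hδ)
    rw [← ENNReal.ofReal_coe_nnreal, ← ofReal_measureReal (measure_ne_top μ _)]
    exact ENNReal.ofReal_le_ofReal h2
  have hA'm : MeasurableSet (A \ ⋃ k, E k) := hAm.diff (MeasurableSet.iUnion hEm)
  have hA' : 0 < μ (A \ ⋃ k, E k) := by
    refine lt_of_lt_of_le (tsub_pos_of_lt ?_) (le_measure_sdiff)
    exact ((measure_iUnion_le E).trans (ENNReal.tsum_le_tsum hE)).trans_lt hηsum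
  obtain ⟨_, hy, y, hyX, rfl⟩ := hG _ hA'm hA'
  -- The point `y` is independent of `k` because all exceptional sets `E k` were removed at once.
  have hlow : ∀ k, δ / 2 ≤ y (w k) := fun k => by
    refine averageRange_eval_ge μ (fun C hC hCA => ?_) hy
    rw [← hgν k C hC, mul_comm, ← smul_eq_mul, ← setIntegral_const]
    refine setIntegral_mono_on (integrable_const _) (L1.integrable_coeFn (g k)).integrableOn hC
      fun x hx => ?_
    have h1 : δ ≤ f x := (hCA hx).1.2
    have h2 : |g k x - f x| < δ / 2 := not_le.1 fun h => (hCA hx).2 (mem_iUnion.2 ⟨k, h⟩)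
    linarith [(abs_lt.1 h2).1]
  obtain ⟨k, hk⟩ := eventually_atTop.1 ((hz y hyX).eventually (gt_mem_nhds (half_pos hδ)))
  have hup : convexHull ℝ (z '' Ici k) ⊆ {v | y v < δ / 2} :=
    convexHull_min (by rintro _ ⟨n, hn, rfl⟩; exact hk n hn)
      (convex_halfSpace_lt (f := fun v => y v) y.toLinearMap.isLinear _)
  exact absurd (hup (hw k)) (not_lt.2 (hlow k))

end Main

theorem theorem5 {Ω : Type*} [MeasurableSpace Ω] (μ : MeasureTheory.Measure Ω)
    [MeasureTheory.IsFiniteMeasure μ]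
    {Z : Type*} [NormedAddCommGroup Z] [NormedSpace ℝ Z] [CompleteSpace Z]
    (X : Submodule ℝ (StrongDual ℝ Z)) (hXclosed : IsClosed (X : Set (StrongDual ℝ Z)))
    (hXnorming : IsNorming X)
    (ν : MeasureTheory.VectorMeasure Ω (StrongDual ℝ Z))
    (hν : ν.AbsolutelyContinuous μ.toENNRealVectorMeasure)
    (hG : ConditionG μ ν X) :
    ∀ B : Set Ω, MeasurableSet B →
      @SeqContinuous Z ℝ (sigmaTopology X) inferInstance (fun z => ν B z) := by
  intro B hB z z₀ hz
  have hν' : ∀ A, MeasurableSet A → μ A = 0 → ν A = 0 := fun A hA h0 =>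
    hν (by rwa [Measure.toENNRealVectorMeasure_apply_measurable hA])
  have hzX : ∀ x ∈ X, Tendsto (fun n => x (z n - z₀)) atTop (𝓝 0) := fun x hx => by
    have h := ((WeakBilin.eval_continuous (evalPairing X) ⟨x, hx⟩).tendsto z₀).comp hz
    have h' : Tendsto (fun n => x (z n)) atTop (𝓝 (x z₀)) := h
    simpa using h'.sub_const (x z₀)
  obtain ⟨M, hM⟩ := hXnorming.exists_norm_le hXclosed hzX
  have h1 := fun ε (hε : 0 < ε) => hG.not_frequently_le hν' hM hzX hB hε
  -- The negated sequence supplies the lower estimate.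
  have h2 := fun ε (hε : 0 < ε) => hG.not_frequently_le hν' (z := fun n => -(z n - z₀))
    (fun n => by rw [norm_neg]; exact hM n)
    (fun x hx => by simpa only [map_neg, neg_zero] using (hzX x hx).neg) hB hε
  change Tendsto (fun n => ν B (z n)) atTop (𝓝 (ν B z₀))
  rw [Metric.tendsto_nhds]
  intro ε hε
  filter_upwards [not_frequently.1 (h1 ε hε), not_frequently.1 (h2 ε hε)] with n hn1 hn2
  rw [map_neg, map_sub, not_le] at hn2
  rw [map_sub, not_le] at hn1
  rw [Real.dist_eq, abs_lt]
  constructor <;> linarith
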